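/- Let $z_1,z_2,\dots$ be i.i.d. nonnegative random variables (the squared magnitudes of the fading coefficients in successive blocks), let $\mathrm{SNR}>0$ and $R\ge 0$, put $C_i=\log_2(1+\mathrm{SNR}\,z_i)$, and assume $\mathbb{E}\{C_1\}>0$ (possibly $+\infty$). A message of rate $R$ whose transmission starts in block $n+1$ is decoded after $M$ blocks, where $M\ge 1$ is the least integer with $R<\sum_{i=1}^{M}C_{n+i}$. Messages are sent one after the other: the first one starts in block $1$, and each later one in the block right after the previous message is decoded. Let $T_l$ be the number of blocks used by the $l$-th message, let $$T=T_1=\min\Big\{M\ge 1:\ R<\sum_{i=1}^{M}\log_2(1+\mathrm{SNR}\,z_i)\Big\},$$ and, for real $t>0$, let $N_t=\max\{k\ge 0:\ \sum_{l=1}^{k}T_l<t\}$ and $S_t=R\,N_t$. Then, almost surely, a message starting in any block is decoded after finitely many blocks; the mean $\mu_1$ and the variance $\sigma^2$ of $T$ are finite; for all $\theta\neq 0$ sufficiently close to $0$ the effective capacity $$C_E(\theta)=-\lim_{t\to\infty}\frac{1}{\theta t}\log_e\mathbb{E}\{e^{-\theta S_t}\}=-\lim_{t\to\infty}\frac{1}{\theta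 t}\log_e\mathbb{E}\{e^{-\theta R N_t}\}$$ exists; and $$C_E(\theta)=\frac{R}{\mu_1}-\frac{R^2\sigma^2}{2\mu_1^3}\,\theta+o(\theta)\qquad(\theta\to 0),$$ where $\lim_{\theta\to0}o(\theta)/\theta=0$. -/

import Mathlib

open Filter Topology MeasureTheory ProbabilityTheory

noncomputable section

namespace HARQ

variable {Ω : Type*}

/-- Instantaneous capacity `log₂ (1 + snr * z i)` (bit/s/Hz) of the `i`-th fading block, where
`z i` is the squared magnitude of the fading coefficient. Blocks are numbered from `0`. -/
def capacity (snr : ℝ) (z : ℕ → Ω → ℝ) (i : ℕ) (ω : Ω) : ℝ :=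
  Real.logb 2 (1 + snr * z i ω)

/-- `M` subblocks, sent in the blocks `n, …, n + M - 1`, suffice for decoding a message of
rate `R`. -/
def Decodable (snr R : ℝ) (z : ℕ → Ω → ℝ) (n M : ℕ) (ω : Ω) : Prop :=
  R < ∑ i ∈ Finset.range M, capacity snr z (n + i) ω

/-- Number of blocks used by a message whose first subblock is sent in block `n`: the least
`M ≥ 1` for which the accumulated capacity exceeds `R`. (The value is `0` if there is no such
`M`.) -/
def transmissionTime (snr R : ℝ) (z : ℕ → Ω → ℝ) (n : ℕ) (ω : Ω) : ℕ :=
  sInf {M : ℕ | 1 ≤ M ∧ Decodable snr R z n M ω}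

/-- The block in which the `l`-th message (`l = 0, 1, …`) starts: the first message starts in
block `0`, and each later one in the block right after the previous message is decoded. -/
def startBlock (snr R : ℝ) (z : ℕ → Ω → ℝ) : ℕ → Ω → ℕ
  | 0, _ => 0
  | l + 1, ω =>
      startBlock snr R z l ω + transmissionTime snr R z (startBlock snr R z l ω) ω

/-- Duration of the transmission of the `l`-th message (`l = 0, 1, …`). -/
def duration (snr R : ℝ) (z : ℕ → Ω → ℝ) (l : ℕ) (ω : Ω) : ℕ :=
  transmissionTime snr R z (startBlock snr R z l ω) ω

/-- The renewal counting process: the largest `k` such that the durations of the first `k`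
messages add up to less than `t`. -/
def renewalCount (snr R : ℝ) (z : ℕ → Ω → ℝ) (t : ℝ) (ω : Ω) : ℕ :=
  sSup {k : ℕ | ((∑ l ∈ Finset.range k, duration snr R z l ω : ℕ) : ℝ) < t}

/-- The accumulated service process `S_t = R N_t`. -/
def service (snr R : ℝ) (z : ℕ → Ω → ℝ) (t : ℝ) (ω : Ω) : ℝ :=
  R * renewalCount snr R z t ω

/-- `-(1 / (θ t)) log E[exp (-θ S_t)]`. -/
def scaledLogMGF [MeasurableSpace Ω] (P : Measure Ω) (snr R : ℝ) (z : ℕ → Ω → ℝ)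
    (θ t : ℝ) : ℝ :=
  -(1 / (θ * t) * Real.log (∫ ω, Real.exp (-θ * service snr R z t ω) ∂P))

/-- `C` is the effective capacity at the QoS exponent `θ`: the limit of
`-(1 / (θ t)) log E[exp (-θ S_t)]` as `t → ∞` exists and equals `C`. -/
def IsEffectiveCapacity [MeasurableSpace Ω] (P : Measure Ω) (snr R : ℝ) (z : ℕ → Ω → ℝ)
    (θ C : ℝ) : Prop :=
  Tendsto (fun t : ℝ => scaledLogMGF P snr R z θ t) atTop (𝓝 C)

end HARQ

end

/-! Conditioning on the duration `T` of the first message turns `a n = E[exp (-θ R N_n)]` into a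
renewal equation: with `p j = P(T = j)` and `q = exp (-θ R)`, a value `j < n` contributes `q * a (n
- j)` and `j ≥ n` contributes `1`. The trial solution `exp (-s n)` balances it when `q * E[exp (s
T)] = 1`, i.e. `Λ s = θ R` with `Λ` the cumulant generating function of `T`. Only the growth rate of
`a` matters, so comparing with exponents slightly off `s` gives `log (a n) / n → -s`
(`tendsto_log_renewal_div`) without a renewal theorem. Hence `C_E θ = Λ⁻¹(θ R) / θ`. A Chernoff
bound gives `T` an exponential tail, so `Λ` is analytic at `0`, with `Λ 0 = 0`, `Λ' 0 = μ₁ ≥ 1` and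
`Λ'' 0 = σ²`. Inverting to second order (`exists_local_inverse_isLittleO`) and dividing by `θ` gives
the expansion. -/

namespace HARQ

/-! ### Growth rate of solutions of a discrete renewal equation. -/

/-- Exponential upper bound for the solution of a renewal equation. -/
theorem renewal_le_exp {p a : ℕ → ℝ} {q s β : ℝ} (hp : ∀ j, 0 ≤ p j) (hp0 : p 0 = 0)
    (hq : 0 < q) (hβ0 : 0 ≤ β) (hsβ : s ≤ β)
    (hβ : Summable fun j : ℕ => p j * Real.exp (β * j))
    (h1 : q * ∑' j : ℕ, p j * Real.exp (s * j) < 1)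
    (ha : ∀ n, HasSum (fun j => p j * if j < n then q * a (n - j) else 1) (a n)) :
    ∃ C, 0 < C ∧ ∀ n : ℕ, a n ≤ C * Real.exp (-s * n) := by
  have hs : Summable fun j : ℕ => p j * Real.exp (s * j) := by
    refine hβ.of_nonneg_of_le (fun j => mul_nonneg (hp j) (Real.exp_pos _).le) fun j => ?_
    have := hp j
    gcongr
  set f := ∑' j : ℕ, p j * Real.exp (s * j) with hf
  set B := ∑' j : ℕ, p j * Real.exp (β * j) with hB
  have hB0 : 0 ≤ B := tsum_nonneg fun j => mul_nonneg (hp j) (Real.exp_pos _).le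
  have hd : 0 < 1 - q * f := by linarith
  -- Fixed point of `C = q * C * f + B + 1`, which closes the induction: `B` absorbs the terms `j ≥
  -- n`, and the extra `1` keeps `C` positive.
  set C := (B + 1) / (1 - q * f) with hC
  have hCpos : 0 < C := by positivity
  have hCeq : q * C * f + B + 1 = C := by
    rw [hC]; field_simp; ring
  refine ⟨C, hCpos, fun n => ?_⟩
  induction n using Nat.strong_induction_on with
  | _ n ih =>
    have hsum : HasSum (fun j : ℕ => q * C * Real.exp (-s * n) * (p j * Real.exp (s * j)) +
        Real.exp (-s * n) * (p j * Real.exp (β * j)))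
        (q * C * Real.exp (-s * n) * f + Real.exp (-s * n) * B) :=
      (hs.hasSum.mul_left _).add (hβ.hasSum.mul_left _)
    refine (hasSum_le (fun j => ?_) (ha n) hsum).trans ?_
    · rcases Nat.eq_zero_or_pos j with rfl | hj
      · simp [hp0]
      · have hpj := hp j
        split_ifs with hjn
        · have h := ih (n - j) (by omega)
          have he : Real.exp (-s * ((n - j : ℕ) : ℝ)) =
              Real.exp (-s * n) * Real.exp (s * j) := by
            rw [← Real.exp_add, Nat.cast_sub hjn.le]; ring_nf
          rw [he] at h
          have h2 : p j * (q * a (n - j)) ≤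
              p j * (q * (C * (Real.exp (-s * n) * Real.exp (s * j)))) := by gcongr
          have h3 : 0 ≤ Real.exp (-s * n) * (p j * Real.exp (β * j)) := by positivity
          linarith
        · have h2 : 1 ≤ Real.exp (-s * n) * Real.exp (β * j) := by
            rw [← Real.exp_add]
            apply Real.one_le_exp
            have : (n : ℝ) ≤ j := by exact_mod_cast not_lt.1 hjn
            nlinarith [mul_nonneg hβ0 (sub_nonneg.2 this),
              mul_nonneg (sub_nonneg.2 hsβ) (Nat.cast_nonneg (α := ℝ) n)]
          have h3 : p j * 1 ≤ p j * (Real.exp (-s * n) * Real.exp (β * j)) := by gcongr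
          have h4 : 0 ≤ q * C * Real.exp (-s * n) * (p j * Real.exp (s * j)) := by positivity
          linarith
    · have : 0 < Real.exp (-s * n) := Real.exp_pos _
      nlinarith

/-- Exponential lower bound for the solution of a renewal equation. -/
theorem exp_le_renewal {p a : ℕ → ℝ} {q s : ℝ} (hp : ∀ j, 0 ≤ p j) (hp0 : p 0 = 0)
    (hq : 0 < q) (hs : Summable fun j : ℕ => p j * Real.exp (s * j))
    (h1 : 1 < q * ∑' j : ℕ, p j * Real.exp (s * j)) (hpos : ∀ n, 0 < a n)
    (ha : ∀ n, HasSum (fun j => p j * if j < n then q * a (n - j) else 1) (a n)) :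
    ∃ c, 0 < c ∧ ∀ n : ℕ, c * Real.exp (-s * n) ≤ a n := by
  -- Finitely many `j` already make the sum exceed `1`. Once `n ≥ N`, each of these satisfies `j <
  -- n`, so the boundary terms can be dropped; the finitely many `n < N` only affect `c`.
  obtain ⟨N, hN⟩ : ∃ N, 1 < q * ∑ j ∈ Finset.range N, p j * Real.exp (s * j) :=
    ((hs.hasSum.tendsto_sum_nat.const_mul q).eventually_const_lt h1).exists
  obtain ⟨c, hc, hcN⟩ : ∃ c, 0 < c ∧ ∀ n < N, c * Real.exp (-s * n) ≤ a n := by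
    clear hN
    induction N with
    | zero => exact ⟨1, one_pos, by simp⟩
    | succ N ih =>
      obtain ⟨c, hc, h⟩ := ih
      refine ⟨min c (a N * Real.exp (s * N)),
        lt_min hc (mul_pos (hpos N) (Real.exp_pos _)), fun n hn => ?_⟩
      rcases Nat.lt_succ_iff_lt_or_eq.1 hn with hn | rfl
      · exact (mul_le_mul_of_nonneg_right (min_le_left _ _) (Real.exp_pos _).le).trans (h n hn)
      · refine (mul_le_mul_of_nonneg_right (min_le_right _ _) (Real.exp_pos _).le).trans ?_
        rw [mul_assoc, ← Real.exp_add]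
        simp
  refine ⟨c, hc, fun n => ?_⟩
  induction n using Nat.strong_induction_on with
  | _ n ih =>
    rcases lt_or_ge n N with hn | hn
    · exact hcN n hn
    · have h2 : ∑ j ∈ Finset.range N, (p j * if j < n then q * a (n - j) else 1) ≤ a n := by
        refine sum_le_hasSum _ (fun j _ => mul_nonneg (hp j) ?_) (ha n)
        have := hpos (n - j)
        split_ifs <;> positivity
      refine le_trans ?_ h2
      have h3 : c * Real.exp (-s * n) * (q * ∑ j ∈ Finset.range N, p j * Real.exp (s * j)) ≤
          ∑ j ∈ Finset.range N, (p j * if j < n then q * a (n - j) else 1) := by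
        rw [← mul_assoc, Finset.mul_sum]
        refine Finset.sum_le_sum fun j hj => ?_
        have hj := Finset.mem_range.1 hj
        rw [if_pos (by omega)]
        rcases Nat.eq_zero_or_pos j with rfl | hj0
        · simp [hp0]
        · have h := ih (n - j) (by omega)
          have he : Real.exp (-s * ((n - j : ℕ) : ℝ)) =
              Real.exp (-s * n) * Real.exp (s * j) := by
            rw [← Real.exp_add, Nat.cast_sub (by omega)]; ring_nf
          rw [he] at h
          have hpj := hp j
          calc _ = p j * (q * (c * (Real.exp (-s * n) * Real.exp (s * j)))) := by ring
            _ ≤ _ := by gcongr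
      refine le_trans ?_ h3
      exact le_mul_of_one_le_right (by positivity) hN.le

/-- The exponential growth rate of the solution of a renewal equation. -/
theorem tendsto_log_renewal_div {p a : ℕ → ℝ} {q s β : ℝ} (hp : ∀ j, 0 ≤ p j) (hp0 : p 0 = 0)
    (hq : 0 < q) (hβ0 : 0 ≤ β) (hsβ : s < β)
    (hβ : Summable fun j : ℕ => p j * Real.exp (β * j))
    (h1 : q * ∑' j : ℕ, p j * Real.exp (s * j) = 1) (hpos : ∀ n, 0 < a n)
    (ha : ∀ n, HasSum (fun j => p j * if j < n then q * a (n - j) else 1) (a n)) :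
    Tendsto (fun n : ℕ => Real.log (a n) / n) atTop (𝓝 (-s)) := by
  have hsum : ∀ r ≤ β, Summable fun j : ℕ => p j * Real.exp (r * j) := fun r hr => by
    refine hβ.of_nonneg_of_le (fun j => mul_nonneg (hp j) (Real.exp_pos _).le) fun j => ?_
    have := hp j
    gcongr
  -- Since `p 0 = 0`, every jump is at least `1`, which makes the monotonicity strict by a factor
  -- `exp (r - t)`. So `s` separates the regimes of the two bounds.
  have hmono : ∀ r t, r < t → t ≤ β → ∑' j : ℕ, p j * Real.exp (r * j) ≤
      Real.exp (r - t) * ∑' j : ℕ, p j * Real.exp (t * j) := fun r t hrt ht => by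
    rw [← tsum_mul_left]
    refine (hsum r (hrt.le.trans ht)).tsum_le_tsum (fun j => ?_) ((hsum t ht).mul_left _)
    rcases Nat.eq_zero_or_pos j with rfl | hj
    · simp [hp0]
    · have hpj := hp j
      have : (1 : ℝ) ≤ j := by exact_mod_cast hj
      calc p j * Real.exp (r * j) ≤ p j * Real.exp ((r - t) + t * j) := by
            gcongr
            nlinarith
        _ = _ := by rw [Real.exp_add]; ring
  have hlim : ∀ b r : ℝ, Tendsto (fun n : ℕ => b / n + -r) atTop (𝓝 (-r)) := fun b r => by
    simpa using (tendsto_const_div_atTop_nhds_zero_nat b).add_const (-r)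
  refine tendsto_order.2 ⟨fun x hx => ?_, fun x hx => ?_⟩
  · obtain ⟨t, hst, ht⟩ : ∃ t, s < t ∧ t < min β (-x) := exists_between (lt_min hsβ (by linarith))
    have htβ := (lt_min_iff.1 ht).1.le
    have htx := (lt_min_iff.1 ht).2
    obtain ⟨c, hc, h⟩ := exp_le_renewal hp hp0 hq (hsum t htβ) (by
      have h3 : q * ∑' j : ℕ, p j * Real.exp (s * j) ≤
        q * (Real.exp (s - t) * ∑' j : ℕ, p j * Real.exp (t * j)) :=
        mul_le_mul_of_nonneg_left (hmono s t hst htβ) hq.le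
      rw [h1] at h3
      have h4 : Real.exp (s - t) < 1 := Real.exp_zero ▸ Real.exp_lt_exp.2 (by linarith)
      have h5 := Real.exp_pos (s - t)
      by_contra! h6
      nlinarith) hpos ha
    filter_upwards [(hlim (Real.log c) t).eventually_const_lt (show x < -t by linarith),
      eventually_gt_atTop 0] with n hn hn0
    have hn0' : (0 : ℝ) < n := by exact_mod_cast hn0
    refine hn.trans_le ?_
    rw [le_div_iff₀ hn0', add_mul, div_mul_cancel₀ _ hn0'.ne']
    have := Real.log_le_log (by positivity) (h n)
    rwa [Real.log_mul hc.ne' (Real.exp_pos _).ne', Real.log_exp] at this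
  · obtain ⟨t, hxt, hts⟩ : ∃ t, -x < t ∧ t < s := exists_between (by linarith)
    obtain ⟨C, hC, h⟩ := renewal_le_exp hp hp0 hq hβ0 (hts.trans hsβ).le hβ (by
      have h3 : q * ∑' j : ℕ, p j * Real.exp (t * j) ≤
        q * (Real.exp (t - s) * ∑' j : ℕ, p j * Real.exp (s * j)) :=
        mul_le_mul_of_nonneg_left (hmono t s hts hsβ.le) hq.le
      have h4 : Real.exp (t - s) < 1 := Real.exp_zero ▸ Real.exp_lt_exp.2 (by linarith)
      rw [mul_left_comm, h1] at h3
      linarith) ha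
    filter_upwards [(hlim (Real.log C) t).eventually_lt_const (show -t < x by linarith),
      eventually_gt_atTop 0] with n hn hn0
    have hn0' : (0 : ℝ) < n := by exact_mod_cast hn0
    refine lt_of_le_of_lt ?_ hn
    rw [div_le_iff₀ hn0', add_mul, div_mul_cancel₀ _ hn0'.ne']
    have := Real.log_le_log (hpos n) (h n)
    rwa [Real.log_mul hC.ne' (Real.exp_pos _).ne', Real.log_exp] at this

/-! ### Second-order inversion of an analytic function. -/

/-- Second-order Taylor expansion of an analytic function at the origin. -/
theorem isLittleO_sub_quadratic {f : ℝ → ℝ} (hf : AnalyticAt ℝ f 0) :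
    (fun x => f x - (f 0 + deriv f 0 * x + iteratedDeriv 2 f 0 / 2 * x ^ 2))
      =o[𝓝 0] fun x : ℝ => x ^ 2 := by
  obtain ⟨ε, hε, h⟩ := Metric.eventually_nhds_iff_ball.1 hf.eventually_analyticAt
  have h0 : (0 : ℝ) ∈ Metric.ball (0 : ℝ) ε := Metric.mem_ball_self hε
  have hcd : ContDiffOn ℝ (2 : ℕ) f (Metric.ball 0 ε) := fun x hx =>
    (h x hx).contDiffAt.contDiffWithinAt
  have := taylor_isLittleO (convex_ball (0 : ℝ) ε) h0 hcd
  rw [Metric.isOpen_ball.nhdsWithin_eq h0] at this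
  simp only [sub_zero] at this
  refine this.congr_left fun x => ?_
  rw [taylorWithinEval_succ, taylorWithinEval_succ, taylor_within_zero_eval,
    iteratedDerivWithin_of_isOpen Metric.isOpen_ball h0,
    iteratedDerivWithin_of_isOpen Metric.isOpen_ball h0, iteratedDeriv_one]
  norm_num
  ring

/-- Second-order expansion of the local inverse of an analytic function vanishing at the
origin. -/
theorem exists_local_inverse_isLittleO {f : ℝ → ℝ} (hf : AnalyticAt ℝ f 0) (hf0 : f 0 = 0)
    {m v : ℝ} (hm : deriv f 0 = m) (hm0 : m ≠ 0) (hv : iteratedDeriv 2 f 0 = v) :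
    ∃ g : ℝ → ℝ, Tendsto g (𝓝 0) (𝓝 0) ∧ (∀ᶠ y in 𝓝 0, f (g y) = y) ∧
      (fun y => g y - (y / m - v / (2 * m ^ 3) * y ^ 2)) =o[𝓝 0] fun y : ℝ => y ^ 2 := by
  have hd : HasStrictDerivAt f m 0 := hm ▸ hf.hasStrictDerivAt
  set g := hd.localInverse f m 0 hm0 with hg
  have hgd : HasStrictDerivAt g m⁻¹ 0 := by simpa only [hf0] using hd.to_localInverse hm0
  have hg0 : g 0 = 0 := by
    have := (hd.eventually_left_inverse hm0).self_of_nhds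
    rwa [hf0] at this
  have hinv : ∀ᶠ y in 𝓝 0, f (g y) = y := by
    simpa only [hf0] using hd.eventually_right_inverse hm0
  have hgt : Tendsto g (𝓝 0) (𝓝 0) := by
    have := hgd.hasDerivAt.continuousAt.tendsto
    rwa [hg0] at this
  refine ⟨g, hgt, hinv, ?_⟩
  have h1 : (fun y => g y - y / m) =o[𝓝 0] fun y : ℝ => y := by
    have := hgd.hasDerivAt.isLittleO
    simp only [hg0, sub_zero, smul_eq_mul] at this
    exact this.congr_left fun y => by rw [div_eq_mul_inv]
  have h2 : g =O[𝓝 0] fun y : ℝ => y := by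
    have := hgd.hasDerivAt.isBigO_sub
    simpa only [hg0, sub_zero] using this
  have h3 : (fun y => f (g y) - (m * g y + v / 2 * g y ^ 2)) =o[𝓝 0] fun y : ℝ => y ^ 2 := by
    have := (isLittleO_sub_quadratic hf).comp_tendsto hgt
    simp only [hf0, hm, hv, zero_add] at this
    exact this.trans_isBigO (h2.pow 2)
  -- Replaces `g y ^ 2` by `(y / m) ^ 2` in the Taylor formula: the difference factors as `o(y) *
  -- O(y)`.
  have h4 : (fun y => (g y - y / m) * (g y + y / m)) =o[𝓝 0] fun y : ℝ => y ^ 2 := by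
    have h5 : (fun y => g y + y / m) =O[𝓝 0] fun y : ℝ => y := by
      refine h2.add ?_
      simp_rw [div_eq_inv_mul]
      exact (Asymptotics.isBigO_refl _ _).const_mul_left _
    exact (h1.mul_isBigO h5).congr_right fun y => by ring
  refine ((h3.add (h4.const_mul_left (v / 2))).const_mul_left (-(1 / m))).congr' ?_ .rfl
  filter_upwards [hinv] with y hy
  rw [hy]
  field_simp
  ring

/-! ### Pathwise renewal structure of the protocol. -/

section Pathwise

variable {Ω : Type*} {snr R : ℝ} {z : ℕ → Ω → ℝ} {ω : Ω}

theorem decodable_shift (n m M : ℕ) :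
    Decodable snr R (fun i => z (n + i)) m M ω ↔ Decodable snr R z (n + m) M ω := by
  simp only [Decodable, capacity, add_assoc]

theorem transmissionTime_shift (n m : ℕ) :
    transmissionTime snr R (fun i => z (n + i)) m ω = transmissionTime snr R z (n + m) ω := by
  simp only [transmissionTime, decodable_shift]

/-- After the first message the protocol restarts on the shifted fading sequence. -/
theorem startBlock_succ_eq_add_shift {T : ℕ} (hT : transmissionTime snr R z 0 ω = T) (l : ℕ) :
    startBlock snr R z (l + 1) ω = T + startBlock snr R (fun i => z (T + i)) l ω := by
  induction l with
  | zero => simp [startBlock, hT]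
  | succ l ih =>
    rw [startBlock, ih, startBlock, transmissionTime_shift, add_assoc]

theorem sum_duration (k : ℕ) :
    ∑ l ∈ Finset.range k, duration snr R z l ω = startBlock snr R z k ω := by
  induction k with
  | zero => rfl
  | succ k ih => rw [Finset.sum_range_succ, ih, startBlock, duration]

theorem startBlock_eval (l : ℕ) :
    startBlock snr R z l ω = startBlock snr R (fun i (x : ℕ → ℝ) => x i) l (fun i => z i ω) := by
  induction l with
  | zero => rfl
  | succ l ih => rw [startBlock, startBlock, ← ih]; rfl

theorem renewalCount_natCast (n : ℕ) :
    renewalCount snr R z n ω = sSup {k | startBlock snr R z k ω < n} := by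
  simp only [renewalCount, sum_duration, Nat.cast_lt]

/-- Durations are integers, so real times reduce to natural ones. -/
theorem renewalCount_eq_ceil (t : ℝ) :
    renewalCount snr R z t ω = renewalCount snr R z (⌈t⌉₊ : ℝ) ω := by
  rw [renewalCount_natCast]
  simp only [renewalCount, sum_duration, Nat.lt_ceil]

/-- The count is a functional of the fading path alone, so its law is determined by the law of the
path. -/
theorem renewalCount_eval (t : ℝ) :
    renewalCount snr R z t ω =
      renewalCount snr R (fun i (x : ℕ → ℝ) => x i) t (fun i => z i ω) := by
  rw [renewalCount_eq_ceil, renewalCount_natCast, renewalCount_eq_ceil, renewalCount_natCast]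
  simp only [startBlock_eval (z := z)]

theorem transmissionTime_spec {n : ℕ} (h : ∃ M, 1 ≤ M ∧ Decodable snr R z n M ω) :
    1 ≤ transmissionTime snr R z n ω ∧
      Decodable snr R z n (transmissionTime snr R z n ω) ω :=
  Nat.sInf_mem h

theorem le_startBlock (h : ∀ n, ∃ M, 1 ≤ M ∧ Decodable snr R z n M ω) (l : ℕ) :
    l ≤ startBlock snr R z l ω := by
  induction l with
  | zero => exact Nat.zero_le _
  | succ l ih => exact Nat.add_le_add ih (transmissionTime_spec (h _)).1

theorem renewalCount_of_le {n : ℕ} (hT : n ≤ transmissionTime snr R z 0 ω) :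
    renewalCount snr R z n ω = 0 := by
  rw [renewalCount_natCast]
  refine Nat.le_zero.1 (csSup_le' fun k hk => ?_)
  cases k with
  | zero => exact le_rfl
  | succ k =>
    rw [Set.mem_ofPred_eq, startBlock_succ_eq_add_shift rfl] at hk
    omega

theorem renewalCount_of_lt (h : ∀ n, ∃ M, 1 ≤ M ∧ Decodable snr R z n M ω) {n T : ℕ}
    (hT : transmissionTime snr R z 0 ω = T) (hTn : T < n) :
    renewalCount snr R z n ω = renewalCount snr R (fun i => z (T + i)) (n - T : ℕ) ω + 1 := by
  have h' : ∀ m, ∃ M, 1 ≤ M ∧ Decodable snr R (fun i => z (T + i)) m M ω := fun m => by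
    simpa only [decodable_shift] using h (T + m)
  rw [renewalCount_natCast, renewalCount_natCast]
  set A := {k | startBlock snr R (fun i => z (T + i)) k ω < n - T} with hA
  -- Each duration is at least `1`. Boundedness matters because `sSup` of an unbounded set of
  -- naturals is `0`.
  have hAb : BddAbove A := ⟨n - T, fun k hk => (le_startBlock h' k).trans (le_of_lt hk)⟩
  have hAn : A.Nonempty := ⟨0, show 0 < n - T by omega⟩
  have key : ∀ k, startBlock snr R z (k + 1) ω < n ↔ k ∈ A := fun k => by
    rw [startBlock_succ_eq_add_shift hT, hA, Set.mem_ofPred_eq]; omega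
  refine IsGreatest.csSup_eq ⟨(key _).2 (Nat.sSup_mem hAn hAb), fun k hk => ?_⟩
  cases k with
  | zero => exact Nat.zero_le _
  | succ k => exact Nat.succ_le_succ (le_csSup hAb ((key k).1 hk))

theorem renewalCount_le (h : ∀ n, ∃ M, 1 ≤ M ∧ Decodable snr R z n M ω) (n : ℕ) :
    renewalCount snr R z n ω ≤ n := by
  rw [renewalCount_natCast]
  exact csSup_le' fun k hk => (le_startBlock h k).trans (le_of_lt hk)

theorem transmissionTime_eq_succ_iff (n j : ℕ) :
    transmissionTime snr R z n ω = j + 1 ↔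
      Decodable snr R z n (j + 1) ω ∧ ∀ M, 1 ≤ M → M ≤ j → ¬ Decodable snr R z n M ω := by
  constructor
  · intro h
    have hne : ∃ M, 1 ≤ M ∧ Decodable snr R z n M ω := by
      by_contra hc
      have : {M : ℕ | 1 ≤ M ∧ Decodable snr R z n M ω} = ∅ :=
        Set.eq_empty_iff_forall_notMem.2 fun M hM => hc ⟨M, hM⟩
      rw [transmissionTime, this] at h
      simp at h
    refine ⟨h ▸ (transmissionTime_spec hne).2, fun M h1 hM hd => ?_⟩
    have : transmissionTime snr R z n ω ≤ M := Nat.sInf_le ⟨h1, hd⟩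
    omega
  · rintro ⟨h1, h2⟩
    refine IsLeast.csInf_eq ⟨⟨by omega, h1⟩, fun M hM => ?_⟩
    by_contra hc
    exact h2 M hM.1 (by omega) hM.2

end Pathwise

/-! ### Measurability of durations, start blocks and counts. -/

section Measurability

variable {Ω : Type*} [MeasurableSpace Ω] {snr R : ℝ} {z : ℕ → Ω → ℝ}

theorem measurable_capacity {i : ℕ} (hz : Measurable (z i)) : Measurable (capacity snr z i) := by
  unfold capacity Real.logb
  fun_prop

theorem measurableSet_decodable {n M : ℕ} (hz : ∀ i < M, Measurable (z (n + i))) :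
    MeasurableSet {ω | Decodable snr R z n M ω} :=
  measurableSet_lt measurable_const <|
    Finset.measurable_fun_sum _ fun i hi => measurable_capacity (hz i (Finset.mem_range.1 hi))

/-- Only the first `j + 1` blocks are required to be measurable, so that the lemma applies to the
σ-algebra they generate. -/
theorem measurableSet_transmissionTime_eq_succ {n j : ℕ}
    (hz : ∀ i < j + 1, Measurable (z (n + i))) :
    MeasurableSet {ω | transmissionTime snr R z n ω = j + 1} := by
  have : {ω | transmissionTime snr R z n ω = j + 1} = {ω | Decodable snr R z n (j + 1) ω} ∩
      ⋂ M, ⋂ (_ : 1 ≤ M), ⋂ (_ : M ≤ j), {ω | Decodable snr R z n M ω}ᶜ := by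
    ext ω
    simp [transmissionTime_eq_succ_iff]
  rw [this]
  refine (measurableSet_decodable hz).inter ?_
  exact .iInter fun M => .iInter fun _ => .iInter fun hM =>
    (measurableSet_decodable fun i hi => hz i (by omega)).compl

theorem measurable_transmissionTime (hz : ∀ i, Measurable (z i)) (n : ℕ) :
    Measurable (transmissionTime snr R z n) := by
  have hsucc : ∀ j, MeasurableSet (transmissionTime snr R z n ⁻¹' {j + 1}) := fun j =>
    measurableSet_transmissionTime_eq_succ fun i _ => hz (n + i)
  refine measurable_to_countable' fun j => ?_
  cases j with
  | zero =>
    have : transmissionTime snr R z n ⁻¹' {0} =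
        (⋃ j, transmissionTime snr R z n ⁻¹' {j + 1})ᶜ := by
      ext ω
      simp only [Set.mem_preimage, Set.mem_singleton_iff, Set.mem_compl_iff, Set.mem_iUnion,
        not_exists]
      exact ⟨fun h j => by omega, fun h => by
        by_contra hc
        exact h (transmissionTime snr R z n ω - 1) (by omega)⟩
    rw [this]
    exact (MeasurableSet.iUnion hsucc).compl
  | succ j => exact hsucc j

theorem measurable_startBlock (hz : ∀ i, Measurable (z i)) (l : ℕ) :
    Measurable (startBlock snr R z l) := by
  induction l with
  | zero => exact measurable_const
  | succ l ih =>
    -- The start block is random, so joint measurability in block and outcome is needed.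
    have h : Measurable fun x : ℕ × Ω => transmissionTime snr R z x.1 x.2 :=
      measurable_from_prod_countable_right fun n => measurable_transmissionTime hz n
    have h2 : Measurable fun ω => transmissionTime snr R z (startBlock snr R z l ω) ω :=
      h.comp (f := fun ω => (startBlock snr R z l ω, ω)) (ih.prodMk measurable_id)
    have h3 : startBlock snr R z (l + 1) = fun ω =>
        startBlock snr R z l ω + transmissionTime snr R z (startBlock snr R z l ω) ω := rfl
    rw [h3]
    exact Measurable.add ih h2

theorem _root_.Nat.sSup_eq_iSup_ite (S : Set ℕ) [DecidablePred (· ∈ S)] :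
    sSup S = ⨆ k, if k ∈ S then k else 0 := by
  by_cases hS : BddAbove S
  · obtain ⟨b, hb⟩ := hS
    have hbdd : BddAbove (Set.range fun k => if k ∈ S then k else 0) := by
      refine ⟨b, ?_⟩
      rintro _ ⟨k, rfl⟩
      dsimp only
      split_ifs with hk
      exacts [hb hk, Nat.zero_le _]
    refine le_antisymm (csSup_le' fun k hk => ?_) (ciSup_le' fun k => ?_)
    · simpa [hk] using le_ciSup hbdd k
    · split_ifs with hk
      exacts [le_csSup ⟨b, hb⟩ hk, Nat.zero_le _]
  · rw [Nat.sSup_of_not_bddAbove hS, iSup, Nat.sSup_of_not_bddAbove]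
    exact fun h => hS (h.mono fun k hk => Set.mem_range.2 ⟨k, if_pos hk⟩)

theorem measurable_renewalCount (hz : ∀ i, Measurable (z i)) (t : ℝ) :
    Measurable (renewalCount snr R z t) := by
  have : renewalCount snr R z t =
      fun ω => ⨆ k, if startBlock snr R z k ω < ⌈t⌉₊ then k else 0 := by
    funext ω
    rw [renewalCount_eq_ceil, renewalCount_natCast]
    exact @Nat.sSup_eq_iSup_ite {k | startBlock snr R z k ω < ⌈t⌉₊}
      fun _ => Nat.decLt _ _
  rw [this]
  exact .iSup fun k => Measurable.ite
    (measurableSet_lt (measurable_startBlock hz k) measurable_const)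
    measurable_const measurable_const

end Measurability

/-! ### Integrals decomposed along an integer-valued variable. -/

section Discrete

variable {Ω : Type*} [MeasurableSpace Ω] {P : Measure Ω} {τ : Ω → ℕ}

theorem hasSum_setIntegral_fiber (hτ : Measurable τ) {g : Ω → ℝ} (hg : Integrable g P) :
    HasSum (fun j => ∫ ω in τ ⁻¹' {j}, g ω ∂P) (∫ ω, g ω ∂P) := by
  have hU : ⋃ j, τ ⁻¹' {j} = Set.univ := by ext; simp
  have := hasSum_integral_iUnion (μ := P) (f := g) (s := fun j => τ ⁻¹' {j})
    (fun j => hτ (measurableSet_singleton j))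
    (fun i j hij => Disjoint.preimage _ (Set.disjoint_singleton.2 hij))
    hg.integrableOn
  rwa [hU, setIntegral_univ] at this

theorem setIntegral_fiber_comp (hτ : Measurable τ) (f : ℕ → ℝ) (j : ℕ) :
    ∫ ω in τ ⁻¹' {j}, f (τ ω) ∂P = P.real (τ ⁻¹' {j}) * f j := by
  rw [setIntegral_congr_fun (g := fun _ => f j) (hτ (measurableSet_singleton j))
    (fun ω hω => by rw [show τ ω = j from hω]), setIntegral_const, smul_eq_mul]

theorem integrable_comp_of_summable [IsFiniteMeasure P] (hτ : Measurable τ) {f : ℕ → ℝ}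
    (hf : ∀ j, 0 ≤ f j)
    (hs : Summable fun j => P.real (τ ⁻¹' {j}) * f j) : Integrable (fun ω => f (τ ω)) P := by
  have hU : ⋃ j, τ ⁻¹' {j} = Set.univ := by ext; simp
  rw [← integrableOn_univ, ← hU]
  refine integrableOn_iUnion_of_summable_integral_norm
    (fun j => ?_) ?_
  · refine (integrableOn_const (C := f j) (measure_ne_top P _)).congr_fun
      (fun ω hω => by rw [show τ ω = j from hω]) (hτ (measurableSet_singleton j))
  · simp_rw [Real.norm_of_nonneg (hf _), setIntegral_fiber_comp hτ]
    exact hs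

end Discrete

/-! ### Almost sure decoding and the exponential tail of the duration. -/

section Tail

theorem capacity_nonneg {Ω : Type*} {snr : ℝ} {z : ℕ → Ω → ℝ} (hsnr : 0 < snr)
    (hz : ∀ i ω, 0 ≤ z i ω) (i : ℕ) (ω : Ω) :
    0 ≤ capacity snr z i ω :=
  Real.logb_nonneg one_lt_two (by nlinarith [mul_nonneg hsnr.le (hz i ω)])

variable {Ω : Type*} [MeasurableSpace Ω] {P : Measure Ω} [IsProbabilityMeasure P]
  {snr R : ℝ} {z : ℕ → Ω → ℝ}

theorem integrable_exp_neg_capacity (hsnr : 0 < snr) (hz_meas : ∀ i, Measurable (z i))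
    (hz : ∀ i ω, 0 ≤ z i ω) (i : ℕ) :
    Integrable (fun ω => Real.exp (-capacity snr z i ω)) P := by
  refine .of_bound (measurable_capacity (hz_meas i)).neg.exp.aestronglyMeasurable 1
    (ae_of_all _ fun ω => ?_)
  rw [Real.norm_of_nonneg (Real.exp_pos _).le]
  exact Real.exp_le_one_iff.2 (neg_nonpos.2 (capacity_nonneg hsnr hz i ω))

/-- A positive mean, even an infinite one, forces the capacity to be positive with positive
probability, and there `exp (-C) < 1`. -/
theorem mgf_capacity_neg_one_lt_one (hsnr : 0 < snr) (hz_meas : ∀ i, Measurable (z i))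
    (hz : ∀ i ω, 0 ≤ z i ω)
    (hcap : 0 < ∫⁻ ω, ENNReal.ofReal (capacity snr z 0 ω) ∂P) :
    mgf (capacity snr z 0) P (-1) < 1 := by
  have hint := integrable_exp_neg_capacity (P := P) hsnr hz_meas hz 0
  have hC := measurable_capacity (snr := snr) (hz_meas 0)
  have h1 : 0 < ∫ ω, (1 - Real.exp (-capacity snr z 0 ω)) ∂P := by
    rw [integral_pos_iff_support_of_nonneg (fun ω => sub_nonneg.2 (Real.exp_le_one_iff.2
      (neg_nonpos.2 (capacity_nonneg hsnr hz 0 ω)))) ((integrable_const 1).sub hint)]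
    rw [lintegral_pos_iff_support (by fun_prop)] at hcap
    refine hcap.trans_le (measure_mono fun ω hω => ?_)
    have : 0 < capacity snr z 0 ω := by simpa using hω
    exact (sub_pos.2 (Real.exp_lt_one_iff.2 (neg_neg_of_pos this))).ne'
  rw [integral_sub (integrable_const 1) hint] at h1
  simp only [integral_const, probReal_univ, smul_eq_mul, mul_one] at h1
  simp only [mgf, neg_one_mul]
  linarith

theorem mgf_capacity_pos (hsnr : 0 < snr) (hz_meas : ∀ i, Measurable (z i))
    (hz : ∀ i ω, 0 ≤ z i ω) : 0 < mgf (capacity snr z 0) P (-1) :=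
  mgf_pos (by simpa only [neg_one_mul] using integrable_exp_neg_capacity hsnr hz_meas hz 0)

/-- Chernoff bound at parameter `-1`; independence factors the generating function of the sum. -/
theorem measureReal_not_decodable_le (hsnr : 0 < snr) (hz_meas : ∀ i, Measurable (z i))
    (hz : ∀ i ω, 0 ≤ z i ω) (hz_indep : iIndepFun z P)
    (hz_ident : ∀ i, IdentDistrib (z i) (z 0) P P) (n M : ℕ) :
    P.real {ω | ¬ Decodable snr R z n M ω} ≤
      Real.exp R * mgf (capacity snr z 0) P (-1) ^ M := by
  have hm : Measurable fun x : ℝ => Real.logb 2 (1 + snr * x) := by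
    unfold Real.logb; fun_prop
  have hind : iIndepFun (fun i => capacity snr z (n + i)) P :=
    (hz_indep.comp (fun _ x => Real.logb 2 (1 + snr * x)) fun _ => hm).precomp
      (add_right_injective n)
  have hmgf : mgf (∑ i ∈ Finset.range M, capacity snr z (n + i)) P (-1) =
      mgf (capacity snr z 0) P (-1) ^ M := by
    rw [hind.mgf_sum (fun i => measurable_capacity (hz_meas _)),
      Finset.prod_congr rfl fun i _ => mgf_congr_of_identDistrib (capacity snr z (n + i))
        (capacity snr z 0) ((hz_ident (n + i)).comp hm) (-1)]
    simp
  have h := measure_le_le_exp_mul_mgf (μ := P) (t := -1)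
    (X := ∑ i ∈ Finset.range M, capacity snr z (n + i)) R (by norm_num) (by
      refine .of_bound (Measurable.aestronglyMeasurable ?_) 1 (ae_of_all _ fun ω => ?_)
      · simp only [Finset.sum_apply]
        exact ((Finset.measurable_fun_sum _ fun i _ =>
          measurable_capacity (hz_meas _)).const_mul _).exp
      · rw [Real.norm_of_nonneg (Real.exp_pos _).le, Real.exp_le_one_iff, Finset.sum_apply]
        have := Finset.sum_nonneg fun i (_ : i ∈ Finset.range M) =>
          capacity_nonneg hsnr hz (n + i) ω
        linarith)
  rw [hmgf, neg_neg, one_mul] at h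
  simpa only [Decodable, not_lt, Finset.sum_apply] using h

theorem ae_forall_exists_decodable (hsnr : 0 < snr) (hz_meas : ∀ i, Measurable (z i))
    (hz : ∀ i ω, 0 ≤ z i ω) (hz_indep : iIndepFun z P)
    (hz_ident : ∀ i, IdentDistrib (z i) (z 0) P P)
    (hcap : 0 < ∫⁻ ω, ENNReal.ofReal (capacity snr z 0 ω) ∂P) :
    ∀ᵐ ω ∂P, ∀ n, ∃ M, 1 ≤ M ∧ Decodable snr R z n M ω := by
  refine ae_all_iff.2 fun n => ?_
  rw [ae_iff, ← measureReal_eq_zero_iff]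
  have hlim : Tendsto (fun M : ℕ => Real.exp R * mgf (capacity snr z 0) P (-1) ^ M) atTop
      (𝓝 0) := by
    simpa using (tendsto_pow_atTop_nhds_zero_of_lt_one (mgf_capacity_pos hsnr hz_meas hz).le
      (mgf_capacity_neg_one_lt_one hsnr hz_meas hz hcap)).const_mul (Real.exp R)
  refine le_antisymm (ge_of_tendsto hlim ?_) measureReal_nonneg
  filter_upwards [eventually_ge_atTop 1] with M hM
  refine (measureReal_mono fun ω hω => ?_).trans
    (measureReal_not_decodable_le hsnr hz_meas hz hz_indep hz_ident n M)
  exact fun hd => hω ⟨M, hM, hd⟩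

theorem measureReal_transmissionTime_eq_zero
    (h : ∀ᵐ ω ∂P, ∀ n, ∃ M, 1 ≤ M ∧ Decodable snr R z n M ω) :
    P.real (transmissionTime snr R z 0 ⁻¹' {0}) = 0 := by
  rw [measureReal_eq_zero_iff]
  refine measure_mono_null (t := {ω | ¬ ∀ n, ∃ M, 1 ≤ M ∧ Decodable snr R z n M ω})
    (fun ω hω hn => ?_) (ae_iff.1 h)
  have := (transmissionTime_spec (hn 0)).1
  rw [show transmissionTime snr R z 0 ω = 0 from hω] at this
  omega

theorem measureReal_transmissionTime_eq_succ_le (hR : 0 ≤ R) (hsnr : 0 < snr)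
    (hz_meas : ∀ i, Measurable (z i))
    (hz : ∀ i ω, 0 ≤ z i ω) (hz_indep : iIndepFun z P)
    (hz_ident : ∀ i, IdentDistrib (z i) (z 0) P P) (j : ℕ) :
    P.real (transmissionTime snr R z 0 ⁻¹' {j + 1}) ≤
      Real.exp R * mgf (capacity snr z 0) P (-1) ^ j := by
  rcases Nat.eq_zero_or_pos j with rfl | hj
  -- For `j = 0` the bound is trivial, since `exp R ≥ 1`; for `j ≥ 1`, the first `j` blocks did not
  -- suffice.
  · simpa using measureReal_le_one.trans (Real.one_le_exp hR)
  · refine (measureReal_mono fun ω hω => ?_).trans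
      (measureReal_not_decodable_le hsnr hz_meas hz hz_indep hz_ident 0 j)
    exact ((transmissionTime_eq_succ_iff 0 j).1 hω).2 j hj le_rfl

theorem exists_summable_exp_transmissionTime (hR : 0 ≤ R) (hsnr : 0 < snr)
    (hz_meas : ∀ i, Measurable (z i))
    (hz : ∀ i ω, 0 ≤ z i ω) (hz_indep : iIndepFun z P)
    (hz_ident : ∀ i, IdentDistrib (z i) (z 0) P P)
    (hcap : 0 < ∫⁻ ω, ENNReal.ofReal (capacity snr z 0 ω) ∂P) :
    ∃ β > 0, ∀ s ≤ β, Summable fun j : ℕ =>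
      P.real (transmissionTime snr R z 0 ⁻¹' {j}) * Real.exp (s * j) := by
  set r := mgf (capacity snr z 0) P (-1) with hr
  have hr0 : 0 < r := mgf_capacity_pos hsnr hz_meas hz
  have hr1 : r < 1 := mgf_capacity_neg_one_lt_one hsnr hz_meas hz hcap
  have hlog : Real.log r < 0 := Real.log_neg hr0 hr1
  -- With half the critical exponent, `r * exp s ≤ √r < 1` for all `s ≤ β`, so a geometric series
  -- dominates.
  refine ⟨-(Real.log r / 2), by linarith, fun s hs => ?_⟩
  have hs' : r * Real.exp s < 1 := by
    calc r * Real.exp s = Real.exp (Real.log r + s) := by rw [Real.exp_add, Real.exp_log hr0]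
      _ < 1 := Real.exp_lt_one_iff.2 (by linarith)
  rw [← summable_nat_add_iff 1]
  refine .of_nonneg_of_le (fun j => by positivity) (fun j => ?_)
    ((summable_geometric_of_lt_one (by positivity) hs').mul_left (Real.exp R * Real.exp s))
  calc _ ≤ (Real.exp R * r ^ j) * Real.exp (s * (j + 1 : ℕ)) := by
        gcongr
        exact measureReal_transmissionTime_eq_succ_le hR hsnr hz_meas hz hz_indep hz_ident j
    _ = _ := by
        rw [mul_pow, ← Real.exp_nat_mul]
        push_cast
        rw [mul_add, Real.exp_add]
        ring_nf

end Tail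

/-! ### The renewal equation and the effective capacity as a root. -/

section Renewal

variable {Ω : Type*} [MeasurableSpace Ω] {P : Measure Ω} {snr R : ℝ} {z : ℕ → Ω → ℝ}

/-- An i.i.d. sequence and its shift have the same path law. -/
theorem integral_exp_renewalCount_shift
    (hz_indep : iIndepFun z P)
    (hz_ident : ∀ i, IdentDistrib (z i) (z 0) P P) (u t : ℝ) (j : ℕ) :
    ∫ ω, Real.exp (u * renewalCount snr R (fun i => z (j + i)) t ω) ∂P =
      ∫ ω, Real.exp (u * renewalCount snr R z t ω) ∂P := by
  have hid : IdentDistrib (fun ω i => z (j + i) ω) (fun ω i => z i ω) P P :=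
    IdentDistrib.pi (X := fun i => z (j + i)) (fun i => (hz_ident (j + i)).trans (hz_ident i).symm)
      (hz_indep.precomp (add_right_injective j)) hz_indep
  have hm : Measurable fun x : ℕ → ℝ =>
      Real.exp (u * renewalCount snr R (fun i (x : ℕ → ℝ) => x i) t x) :=
    ((measurable_from_nat (f := fun k : ℕ => (k : ℝ))).comp
      (measurable_renewalCount (fun i => measurable_pi_apply i) t)).const_mul u |>.exp
  simp_rw [renewalCount_eval (z := z), renewalCount_eval (z := fun i => z (j + i))]
  exact (hid.comp hm).integral_eq

/-- The event that the first message takes `j + 1` blocks is independent of the service offered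
from block `j + 1` on. -/
theorem setIntegral_exp_renewalCount_shift (hz_meas : ∀ i, Measurable (z i))
    (hz_indep : iIndepFun z P) (u t : ℝ) (j : ℕ) :
    ∫ ω in transmissionTime snr R z 0 ⁻¹' {j + 1},
        Real.exp (u * renewalCount snr R (fun i => z (j + 1 + i)) t ω) ∂P =
      P.real (transmissionTime snr R z 0 ⁻¹' {j + 1}) *
        ∫ ω, Real.exp (u * renewalCount snr R (fun i => z (j + 1 + i)) t ω) ∂P := by
  set A := transmissionTime snr R z 0 ⁻¹' {j + 1} with hA
  set Y := fun ω => Real.exp (u * renewalCount snr R (fun i => z (j + 1 + i)) t ω) with hY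
  let m : ℕ → MeasurableSpace Ω := fun i => MeasurableSpace.comap (z i) inferInstance
  have hle : ∀ i, m i ≤ ‹MeasurableSpace Ω› := fun i => (hz_meas i).comap_le
  have hle' : ∀ S : Set ℕ, (⨆ i ∈ S, m i) ≤ ‹MeasurableSpace Ω› := fun S =>
    iSup₂_le fun i _ => hle i
  -- Blocks before `j + 1` and blocks from `j + 1` on generate independent σ-algebras; the event
  -- lies in the first, the later service in the second.
  have hind := indep_iSup_of_disjoint hle hz_indep
    (Set.disjoint_left.2 fun i (hi : i ∈ Set.Iio (j + 1)) (hi' : i ∈ Set.Ici (j + 1)) =>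
      (not_lt.2 (Set.mem_Ici.1 hi')) (Set.mem_Iio.1 hi))
  have hAm1 : @MeasurableSet Ω (⨆ i ∈ Set.Iio (j + 1), m i) A :=
    @measurableSet_transmissionTime_eq_succ Ω (⨆ i ∈ Set.Iio (j + 1), m i) snr R z 0 j
      fun i hi => by
        rw [zero_add]
        exact (comap_measurable (z i)).mono
          (le_iSup₂_of_le (f := fun i (_ : i ∈ Set.Iio (j + 1)) => m i) i hi le_rfl) le_rfl
  have hYm2 : @Measurable Ω ℝ (⨆ i ∈ Set.Ici (j + 1), m i) _ Y := by
    have h := @measurable_renewalCount Ω (⨆ i ∈ Set.Ici (j + 1), m i) snr R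
      (fun i => z (j + 1 + i)) (fun i => (comap_measurable (z (j + 1 + i))).mono
          (le_iSup₂_of_le (f := fun i (_ : i ∈ Set.Ici (j + 1)) => m i) (j + 1 + i)
            (Set.mem_Ici.2 (Nat.le_add_right _ _)) le_rfl) le_rfl) t
    exact (measurable_from_nat (f := fun k : ℕ => Real.exp (u * k))).comp h
  have hAm : MeasurableSet A := hle' _ A hAm1
  have hYm : Measurable Y := hYm2.mono (hle' _) le_rfl
  have hXm1 : @Measurable Ω ℝ (⨆ i ∈ Set.Iio (j + 1), m i) _ (A.indicator fun _ => (1 : ℝ)) :=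
    Measurable.indicator measurable_const hAm1
  have hXY : IndepFun (A.indicator fun _ => (1 : ℝ)) Y P := by
    rw [IndepFun_iff_Indep]
    exact indep_of_indep_of_le_left (indep_of_indep_of_le_right hind hYm2.comap_le) hXm1.comap_le
  have h := hXY.integral_fun_mul_eq_mul_integral
    (measurable_const.indicator hAm).aestronglyMeasurable hYm.aestronglyMeasurable
  rw [integral_indicator_const _ hAm, smul_eq_mul, mul_one] at h
  rw [← h, ← integral_indicator hAm]
  congr 1 with ω
  by_cases hω : ω ∈ A <;> simp [hω, hY]

variable [IsProbabilityMeasure P]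

theorem integrable_exp_renewalCount (hz_meas : ∀ i, Measurable (z i))
    (hdec : ∀ᵐ ω ∂P, ∀ n, ∃ M, 1 ≤ M ∧ Decodable snr R z n M ω) (u : ℝ) (n : ℕ) :
    Integrable (fun ω => Real.exp (u * renewalCount snr R z n ω)) P := by
  refine .of_bound (Measurable.aestronglyMeasurable ?_) (Real.exp (|u| * n)) ?_
  · exact ((measurable_from_nat (f := fun k : ℕ => (k : ℝ))).comp
      (measurable_renewalCount hz_meas n)).const_mul u |>.exp
  · filter_upwards [hdec] with ω hω
    rw [Real.norm_of_nonneg (Real.exp_pos _).le, Real.exp_le_exp]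
    have h1 : (renewalCount snr R z n ω : ℝ) ≤ n := by exact_mod_cast renewalCount_le hω n
    have h2 : (0 : ℝ) ≤ renewalCount snr R z n ω := Nat.cast_nonneg _
    exact mul_le_mul (le_abs_self u) h1 h2 (abs_nonneg u)

/-- Renewal equation for the moment generating function of the renewal count. -/
theorem hasSum_renewal_integral_exp (hz_meas : ∀ i, Measurable (z i))
    (hz_indep : iIndepFun z P)
    (hz_ident : ∀ i, IdentDistrib (z i) (z 0) P P)
    (hdec : ∀ᵐ ω ∂P, ∀ n, ∃ M, 1 ≤ M ∧ Decodable snr R z n M ω) (u : ℝ) (n : ℕ) :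
    HasSum (fun j => P.real (transmissionTime snr R z 0 ⁻¹' {j}) *
        if j < n then Real.exp u *
          ∫ ω, Real.exp (u * renewalCount snr R z ((n - j : ℕ) : ℝ) ω) ∂P else 1)
      (∫ ω, Real.exp (u * renewalCount snr R z n ω) ∂P) := by
  have hτ := measurable_transmissionTime (snr := snr) (R := R) hz_meas 0
  refine (hasSum_setIntegral_fiber hτ
    (integrable_exp_renewalCount hz_meas hdec u n)).congr_fun fun j => ?_
  have hAm : MeasurableSet (transmissionTime snr R z 0 ⁻¹' {j}) := hτ (measurableSet_singleton j)
  split_ifs with hjn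
  · cases j with
    | zero =>
      have h0 := measureReal_transmissionTime_eq_zero hdec
      rw [h0, zero_mul, setIntegral_measure_zero _ (by rwa [measureReal_eq_zero_iff] at h0)]
    | succ j =>
      rw [← integral_exp_renewalCount_shift hz_indep hz_ident u _ (j + 1), mul_left_comm,
        ← setIntegral_exp_renewalCount_shift hz_meas hz_indep, ← integral_const_mul]
      refine setIntegral_congr_ae hAm ?_
      filter_upwards [hdec] with ω hω hT
      rw [renewalCount_of_lt hω hT hjn, ← Real.exp_add]
      push_cast
      ring_nf
  · rw [setIntegral_congr_fun (g := fun _ => (1 : ℝ)) hAm fun ω hω => by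
      have hT : transmissionTime snr R z 0 ω = j := hω
      simp [renewalCount_of_le (hT ▸ not_lt.1 hjn)]]
    simp

theorem isEffectiveCapacity_div (hz_meas : ∀ i, Measurable (z i))
    (hz_indep : iIndepFun z P)
    (hz_ident : ∀ i, IdentDistrib (z i) (z 0) P P)
    (hdec : ∀ᵐ ω ∂P, ∀ n, ∃ M, 1 ≤ M ∧ Decodable snr R z n M ω) {β s θ : ℝ} (hβ0 : 0 ≤ β)
    (hβ : ∀ s ≤ β, Summable fun j : ℕ =>
      P.real (transmissionTime snr R z 0 ⁻¹' {j}) * Real.exp (s * j))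
    (hsβ : s < β) (hθ : θ ≠ 0)
    (hs : cgf (fun ω => (transmissionTime snr R z 0 ω : ℝ)) P s = θ * R) :
    IsEffectiveCapacity P snr R z θ (s / θ) := by
  have hτ := measurable_transmissionTime (snr := snr) (R := R) hz_meas 0
  have hint : Integrable (fun ω => Real.exp (s * (transmissionTime snr R z 0 ω : ℝ))) P :=
    integrable_comp_of_summable hτ (f := fun j => Real.exp (s * j))
      (fun j => (Real.exp_pos _).le) (hβ s hsβ.le)
  have hmgf : ∑' j : ℕ, P.real (transmissionTime snr R z 0 ⁻¹' {j}) * Real.exp (s * j) =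
      Real.exp (θ * R) := by
    rw [← hs, exp_cgf hint, mgf, ← (hasSum_setIntegral_fiber hτ hint).tsum_eq]
    exact tsum_congr fun j =>
      (setIntegral_fiber_comp hτ (fun j : ℕ => Real.exp (s * j)) j).symm
  have hlim := tendsto_log_renewal_div (s := s) (q := Real.exp (-θ * R))
    (p := fun j => P.real (transmissionTime snr R z 0 ⁻¹' {j}))
    (a := fun n : ℕ => ∫ ω, Real.exp (-θ * R * renewalCount snr R z n ω) ∂P)
    (fun j => measureReal_nonneg) (measureReal_transmissionTime_eq_zero hdec) (Real.exp_pos _)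
    hβ0 hsβ (hβ β le_rfl)
    (by rw [hmgf, ← Real.exp_add, neg_mul, neg_add_cancel, Real.exp_zero])
    (fun n => integral_exp_pos (integrable_exp_renewalCount hz_meas hdec _ n))
    (fun n => hasSum_renewal_integral_exp hz_meas hz_indep hz_ident hdec _ n)
  -- Passes from integers to real `t`, using `⌈t⌉₊ / t → 1`.
  have hlim2 := ((hlim.comp (tendsto_nat_ceil_atTop (α := ℝ))).mul
    (tendsto_nat_ceil_div_atTop (R := ℝ))).const_mul (-(1 / θ))
  rw [show -(1 / θ) * (-s * 1) = s / θ by ring] at hlim2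
  refine hlim2.congr' ?_
  filter_upwards [eventually_gt_atTop 0] with t ht
  have hc : ((⌈t⌉₊ : ℕ) : ℝ) ≠ 0 := by
    exact_mod_cast (Nat.ceil_pos.2 ht).ne'
  have hI : ∫ ω, Real.exp (-θ * service snr R z t ω) ∂P =
      ∫ ω, Real.exp (-θ * R * renewalCount snr R z (⌈t⌉₊ : ℝ) ω) ∂P := by
    simp only [service, renewalCount_eq_ceil t, mul_assoc]
  simp only [Function.comp_apply, scaledLogMGF]
  rw [hI]
  field_simp

end Renewal

end HARQ

/-! ### Assembly of the theorem. -/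

theorem theorem1 {Ω : Type*} [MeasurableSpace Ω] (P : Measure Ω) [IsProbabilityMeasure P]
    (z : ℕ → Ω → ℝ) (snr R : ℝ) (hsnr : 0 < snr) (hR : 0 ≤ R)
    (hz_meas : ∀ i, Measurable (z i))
    (hz_nonneg : ∀ i ω, 0 ≤ z i ω)
    (hz_indep : iIndepFun z P)
    (hz_ident : ∀ i, IdentDistrib (z i) (z 0) P P)
    (hcap : 0 < ∫⁻ ω, ENNReal.ofReal (HARQ.capacity snr z 0 ω) ∂P) :
    let T : Ω → ℝ := fun ω => (HARQ.transmissionTime snr R z 0 ω : ℝ)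
    let μ₁ : ℝ := ∫ ω, T ω ∂P
    let σsq : ℝ := variance T P
    (∀ᵐ ω ∂P, ∀ n, ∃ M, 1 ≤ M ∧ HARQ.Decodable snr R z n M ω) ∧
    MemLp T 2 P ∧
    ∃ CE : ℝ → ℝ,
      (∀ᶠ θ in 𝓝[≠] (0 : ℝ), HARQ.IsEffectiveCapacity P snr R z θ (CE θ)) ∧
      (fun θ : ℝ => CE θ - (R / μ₁ - R ^ 2 * σsq / (2 * μ₁ ^ 3) * θ))
        =o[𝓝[≠] (0 : ℝ)] (fun θ : ℝ => θ) := by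
  intro T μ₁ σsq
  have hdec := HARQ.ae_forall_exists_decodable (R := R) hsnr hz_meas hz_nonneg hz_indep hz_ident
    hcap
  obtain ⟨β, hβ0, hβ⟩ := HARQ.exists_summable_exp_transmissionTime hR hsnr hz_meas hz_nonneg
    hz_indep hz_ident hcap
  have hτ := HARQ.measurable_transmissionTime (snr := snr) (R := R) hz_meas 0
  -- The half-line below `β` is an open set of integrable exponents containing `0`; this yields the
  -- finite moments and the analyticity of `cgf T P`.
  have hint : 0 ∈ interior (integrableExpSet T P) :=
    interior_maximal (fun s (hs : s < β) => HARQ.integrable_comp_of_summable hτ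
      (f := fun j => Real.exp (s * j)) (fun j => (Real.exp_pos _).le) (hβ s hs.le))
      isOpen_Iio hβ0
  have hT2 : MemLp T 2 P := by exact_mod_cast memLp_of_mem_interior_integrableExpSet hint 2
  refine ⟨hdec, hT2, ?_⟩
  have hμ : 1 ≤ μ₁ := by
    have h := integral_mono_ae (integrable_const (1 : ℝ)) (hT2.integrable one_le_two)
      (hdec.mono fun ω hω => Nat.one_le_cast.2 (HARQ.transmissionTime_spec (hω 0)).1)
    simpa using h
  have hd1 : deriv (cgf T P) 0 = μ₁ := by simp [deriv_cgf_zero hint, μ₁]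
  have hd2 : iteratedDeriv 2 (cgf T P) 0 = σsq := by
    rw [iteratedDeriv_two_cgf hint, hd1]
    simp only [zero_mul, Real.exp_zero, mul_one, mgf_zero, div_one]
    exact (variance_eq_sub hT2).symm
  obtain ⟨g, hg0, hginv, hg⟩ := HARQ.exists_local_inverse_isLittleO (analyticAt_cgf hint) cgf_zero
    hd1 (by linarith) hd2
  have hθR : Tendsto (fun θ : ℝ => θ * R) (𝓝[≠] 0) (𝓝 0) := by
    simpa using ((tendsto_id (α := ℝ) (x := 𝓝 0)).mono_left nhdsWithin_le_nhds).mul_const R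
  -- `g` is the local inverse of `cgf T P`, so `g (θ * R)` is the root `s`; it tends to `0` and is
  -- therefore eventually below `β`.
  refine ⟨fun θ => g (θ * R) / θ, ?_, ?_⟩
  · filter_upwards [hθR.eventually hginv, (hg0.comp hθR).eventually_lt_const hβ0,
      self_mem_nhdsWithin] with θ h1 h2 h3
    exact HARQ.isEffectiveCapacity_div hz_meas hz_indep hz_ident hdec hβ0.le hβ h2 h3 h1
  · have h1 := hg.comp_tendsto hθR
    have h2 : (fun θ : ℝ => (θ * R) ^ 2) =O[𝓝[≠] 0] fun θ : ℝ => θ ^ 2 := by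
      simp_rw [mul_pow, mul_comm _ (R ^ 2)]
      exact (Asymptotics.isBigO_refl _ _).const_mul_left _
    have h3 := (h1.trans_isBigO h2).mul_isBigO (Asymptotics.isBigO_refl (fun θ : ℝ => θ⁻¹) _)
    refine h3.congr' ?_ ?_ <;> filter_upwards [self_mem_nhdsWithin] with θ (hθ : θ ≠ 0)
    · simp only [Function.comp_apply]
      field_simp
    · field_simp
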